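/- Let $d\ge 1$, let $\langle\cdot,\cdot\rangle$ and $\|\cdot\|$ be the Euclidean scalar product and norm on $\mathbb{R}^d$, and for $f\in L^2(\mathbb{R}^d)$ (complex-valued) let $\widehat f\in L^2(\mathbb{R}^d)$ be its ($L^2$, Plancherel) Fourier transform, normalized by $$\widehat f(y)=\int_{\mathbb{R}^d} f(t)\,e^{-2i\pi\langle t,y\rangle}\,dt .$$ **Theorem (Cowling–Price type).** Let $N\ge 0$ be a real number, let $a,b>0$ be real numbers with $ab=1$, and let $f\in L^2(\mathbb{R}^d)$. Assume that for every $j=1,\dots,d$ $$\int_{\mathbb{R}^d}|f(x)|\,\frac{e^{\pi a|x_j|^2}}{(1+|x_j|)^N}\,dx<+\infty \qquad\text{and}\qquad \int_{\mathbb{R}^d}|\widehat f(y)|\,\frac{e^{\pi b|y_j|^2}}{(1+|y_j|)^N}\,dy<+\infty .$$ Then there is a polynomial $P$ in $d$ variables with complex coefficients such that $f(x)=P(x)\,e^{-\pi a\|x\|^2}$ for almost every $x\in\mathbb{R}^d$. -/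

import Mathlib

open MeasureTheory
open scoped FourierTransform

/-! Let `g = 𝓕 f`. Its Gaussian weight makes `g` integrable, so `f` agrees a.e. with the continuous
function `𝓕⁻ g`. Along every line in direction `j` this function extends to an entire `H`; since `ab
= 1`, completing the square gives `|H z| ≤ C (1 + |Im z|)^n exp(πa (Im z)²)`
(`exists_entire_extension_fourierInv`).

By Fubini, on almost every such line the hypothesis on `f` bounds a weighted integral of `G z = H z
* exp(πa z²)` over the real axis. The primitive `K` of `G` then grows polynomially on the real axis
and at most like a polynomial times `exp(πa (Re z)²)` elsewhere. Phragmén–Lindelöf and Liouville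
make `K`, hence `G = K'`, a polynomial of controlled degree (`entire_eq_polynomial_mul_gaussian`).

Lagrange interpolation at fixed nodes turns this into an identity that passes by continuity from
almost every line to every line (`gaussian_mul_eq_lagrange_sum`). Functions polynomial of bounded
degree in each variable are polynomials (`exists_mvPolynomial_of_separately`). -/

/-! ### Fourier inversion on L¹ ∩ L². -/

theorem continuous_fourierInv_of_integrable {E : Type*} [NormedAddCommGroup E]
    [InnerProductSpace ℝ E] [FiniteDimensional ℝ E] [MeasurableSpace E] [BorelSpace E] {g : E → ℂ}
    (hg : Integrable g volume) : Continuous (𝓕⁻ g) :=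
  VectorFourier.fourierIntegral_continuous (μ := (volume : Measure E)) (L := -innerₗ E)
    Real.continuous_fourierChar (continuous_inner (𝕜 := ℝ) (E := E)).neg hg

/-- On `L¹ ∩ L²`, the `L²` inverse Fourier transform is given by the Fourier integral. -/
theorem Lp_fourierInv_ae_eq {E : Type*} [NormedAddCommGroup E] [InnerProductSpace ℝ E]
    [FiniteDimensional ℝ E] [MeasurableSpace E] [BorelSpace E]
    (g : Lp (α := E) ℂ 2 volume) (hg : Integrable g volume) :
    ∀ᵐ x, (𝓕⁻ g : Lp (α := E) ℂ 2 volume) x = 𝓕⁻ (g : E → ℂ) x := by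
  apply ae_eq_of_integral_contDiff_smul_eq
  · exact (Lp.memLp _).locallyIntegrable (by norm_num)
  · exact (continuous_fourierInv_of_integrable hg).locallyIntegrable
  · intro φ hφ hφc
    have hφ₁ : HasCompactSupport (Complex.ofRealCLM ∘ φ) := hφc.comp_left rfl
    have hφ₂ : ContDiff ℝ (⊤ : ℕ∞) (Complex.ofRealCLM ∘ φ) := by fun_prop
    set ψ : SchwartzMap E ℂ := hφ₁.toSchwartzMap hφ₂
    have hψ : ∀ x, ψ x = (φ x : ℂ) := fun x => by simp [ψ]
    -- Duality puts the L² transform on the test function; Fubini (`flip`) moves the integral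
    -- transform back onto `g`.
    have key := congrArg (fun T => T ψ) (Lp.fourierInv_toTemperedDistribution_eq g)
    simp only [TemperedDistribution.fourierInv_apply, Lp.toTemperedDistribution_apply,
      SchwartzMap.fourierInv_coe] at key
    have flip := VectorFourier.integral_fourierIntegral_smul_eq_flip (μ := (volume : Measure E))
      (ν := (volume : Measure E))
      (L := -innerₗ E) (f := (ψ : E → ℂ)) (g := (g : E → ℂ)) Real.continuous_fourierChar
      ((continuous_inner (𝕜 := ℝ) (E := E)).neg) ψ.integrable hg
    have hL : (-innerₗ E).flip = -innerₗ E := by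
      ext x y; simp [real_inner_comm]
    rw [hL] at flip
    have := key.symm.trans flip
    simp only [hψ] at this
    exact this

/-! ### Liouville and Phragmén–Lindelöf. -/

/-- An entire function of polynomial growth is a polynomial. -/
theorem entire_eq_polynomial_of_norm_le {K : ℂ → ℂ} (hK : Differentiable ℂ K) {C : ℝ} {m : ℕ}
    (hC : ∀ z, ‖K z‖ ≤ C * (1 + ‖z‖) ^ m) :
    ∃ p : Polynomial ℂ, p.natDegree ≤ m ∧ ∀ z, K z = p.eval z := by
  have hC0 : 0 ≤ C := by simpa using (norm_nonneg _).trans (hC 0)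
  have hder : ∀ k, m < k → iteratedDeriv k K 0 = 0 := by
    intro k hk
    have hb : ∀ R : ℝ, 1 ≤ R → ‖iteratedDeriv k K 0‖ ≤ (k.factorial * C * 2 ^ m) / R := by
      intro R hR
      have h1 := Complex.norm_iteratedDeriv_le_of_forall_mem_sphere_norm_le (c := 0) (R := R)
        (C := C * (2 * R) ^ m) (f := K) k (by linarith) hK.diffContOnCl (by
          intro z hz
          have : ‖z‖ = R := by simpa using hz
          refine (hC z).trans ?_
          rw [this]
          gcongr
          linarith)
      refine h1.trans ?_
      rw [div_le_div_iff₀ (by positivity) (by positivity), mul_pow]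
      calc k.factorial * (C * (2 ^ m * R ^ m)) * R = k.factorial * C * 2 ^ m * R ^ (m + 1) := by ring
        _ ≤ k.factorial * C * 2 ^ m * R ^ k := by
          gcongr
          exact hk
    have hlim : Filter.Tendsto (fun R : ℝ => (k.factorial * C * 2 ^ m) / R) Filter.atTop (nhds 0) :=
      Filter.Tendsto.const_div_atTop Filter.tendsto_id _
    have := ge_of_tendsto hlim ((Filter.eventually_ge_atTop 1).mono hb)
    exact norm_le_zero_iff.mp this
  refine ⟨∑ k ∈ Finset.range (m + 1),
    Polynomial.monomial k ((k.factorial : ℂ)⁻¹ * iteratedDeriv k K 0), ?_, fun z => ?_⟩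
  · refine Polynomial.natDegree_sum_le_of_forall_le _ _ fun k hk => ?_
    exact (Polynomial.natDegree_monomial_le _).trans (by simpa [Nat.lt_succ_iff] using hk)
  · rw [← Complex.taylorSeries_eq_of_entire' (c := 0) (z := z) hK, Polynomial.eval_finsetSum,
      tsum_eq_sum (s := Finset.range (m + 1))]
    · simp
    · intro k hk
      rw [hder k (by simpa using hk)]
      simp

/-- A Phragmén–Lindelöf principle in a quadrant for the critical order two: boundedness on one side
and Gaussian growth in the real part only. -/
theorem quadrant_norm_le_of_gaussian_growth {L : ℂ → ℂ}
    (hL : ∀ z : ℂ, 0 ≤ z.re → DifferentiableAt ℂ L z) {A C : ℝ} (hA : 0 < A)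
    (hre : ∀ x : ℝ, 0 ≤ x → ‖L x‖ ≤ C)
    (hgr : ∀ z : ℂ, 0 ≤ z.re → 0 ≤ z.im → ‖L z‖ ≤ C * Real.exp (A * z.re ^ 2))
    {z : ℂ} (hz : 0 ≤ z.re) (hz' : 0 ≤ z.im) : ‖L z‖ ≤ C := by
  have hC : 0 ≤ C := (norm_nonneg _).trans (hre 0 le_rfl)
  rcases hz.eq_or_lt with hz0 | hz0
  · simpa [← hz0] using hgr z hz hz'
  -- Order two is critical for a quadrant, so multiply by `exp(iδz²)`, of modulus `exp(-2δxy)`. It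
  -- cancels the Gaussian growth where `y ≥ Ax/(2δ)`, leaving a sector of angle `θ < π/2`, which
  -- `log` maps to a strip. Finally `δ → 0`.
  have key : ∀ δ : ℝ, 0 < δ → ‖L z‖ ≤ C * Real.exp (2 * δ * z.re * z.im) := by
    intro δ hδ
    set F : ℂ → ℂ := fun z => L z * Complex.exp (δ * Complex.I * z ^ 2) with hF
    have hFn : ∀ z, ‖F z‖ = ‖L z‖ * Real.exp (-(2 * δ * z.re * z.im)) := by
      intro z
      rw [hF, norm_mul, Complex.norm_exp]
      congr 2
      simp [pow_two, Complex.mul_re, Complex.mul_im]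
      ring
    suffices h : ‖F z‖ ≤ C by
      rw [hFn, Real.exp_neg, ← div_eq_mul_inv, div_le_iff₀ (Real.exp_pos _)] at h
      exact h
    have hFd : ∀ z : ℂ, 0 ≤ z.re → DifferentiableAt ℂ F z := fun z hz =>
      (hL z hz).mul (by fun_prop)
    have hsteep : ∀ z : ℂ, 0 ≤ z.re → A / (2 * δ) * z.re ≤ z.im → ‖F z‖ ≤ C := by
      intro z hz h
      have him : 0 ≤ z.im := le_trans (by positivity) h
      rw [hFn]
      calc ‖L z‖ * Real.exp (-(2 * δ * z.re * z.im))
          ≤ C * Real.exp (A * z.re ^ 2) * Real.exp (-(2 * δ * z.re * z.im)) := by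
            gcongr; exact hgr z hz him
        _ = C * Real.exp (A * z.re ^ 2 - 2 * δ * z.re * z.im) := by
            rw [mul_assoc, ← Real.exp_add]; ring_nf
        _ ≤ C * 1 := by
            gcongr
            rw [Real.exp_le_one_iff]
            have : A * z.re ≤ 2 * δ * z.im := by
              rw [div_mul_eq_mul_div, div_le_iff₀ (by positivity)] at h
              linarith
            nlinarith
        _ = C := mul_one C
    rcases le_total (A / (2 * δ) * z.re) z.im with h | h
    · exact hsteep z hz h
    set θ := Real.arctan (A / (2 * δ)) with hθ
    have hθ0 : 0 < θ := by
      rw [hθ, Real.arctan_pos]; positivity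
    have hθ1 : θ < Real.pi / 2 := Real.arctan_lt_pi_div_two _
    have hz_ne : z ≠ 0 := fun h => by simp [h] at hz0
    have harg : z.arg = Real.arctan (z.im / z.re) := by
      rw [← Complex.tan_arg, Real.arctan_tan]
      · exact (abs_lt.mp (Complex.abs_arg_lt_pi_div_two_iff.mpr (Or.inl hz0))).1
      · exact (abs_lt.mp (Complex.abs_arg_lt_pi_div_two_iff.mpr (Or.inl hz0))).2
    have hargθ : z.arg ≤ θ := by
      rw [harg, hθ]
      apply Real.arctan_mono
      rwa [div_le_iff₀ hz0]
    have harg0 : 0 ≤ z.arg := Complex.arg_nonneg_iff.mpr hz'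
    have hexpre : ∀ w : ℂ, 0 ≤ w.im → w.im ≤ θ → 0 ≤ (Complex.exp w).re := by
      intro w h0 h1
      rw [Complex.exp_re]
      exact mul_nonneg (Real.exp_pos _).le (Real.cos_nonneg_of_mem_Icc ⟨by linarith, by linarith⟩)
    have hexpim : ∀ w : ℂ, 0 ≤ w.im → w.im ≤ θ → 0 ≤ (Complex.exp w).im := by
      intro w h0 h1
      rw [Complex.exp_im]
      exact mul_nonneg (Real.exp_pos _).le
        (Real.sin_nonneg_of_nonneg_of_le_pi h0 (by linarith [Real.pi_pos]))
    have hmain := PhragmenLindelof.horizontal_strip (a := 0) (b := θ) (C := C)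
      (f := fun w => F (Complex.exp w)) (z := Complex.log z) ?_ ?_ ?_ ?_ ?_ ?_
    · simpa [Complex.exp_log hz_ne] using hmain
    · apply DifferentiableOn.diffContOnCl
      intro w hw
      have hw' : w ∈ Complex.im ⁻¹' Set.Icc 0 θ := by
        have := closure_minimal (Set.preimage_mono (f := Complex.im) Set.Ioo_subset_Icc_self)
          (isClosed_Icc.preimage Complex.continuous_im) hw
        exact this
      exact ((hFd _ (hexpre w hw'.1 hw'.2)).comp w
        Complex.differentiableAt_exp).differentiableWithinAt
    -- Order two is subcritical here: `2 < π/θ`.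
    · refine ⟨2, ?_, A, ?_⟩
      · rw [sub_zero, lt_div_iff₀ hθ0]; linarith
      · refine Asymptotics.IsBigO.of_bound C ?_
        refine Filter.eventually_inf_principal.mpr (Filter.Eventually.of_forall fun w hw => ?_)
        have h0 := hexpre w hw.1.le hw.2.le
        have h1 := hexpim w hw.1.le hw.2.le
        rw [Real.norm_of_nonneg (Real.exp_pos _).le, hFn]
        calc ‖L (Complex.exp w)‖ * Real.exp (-(2 * δ * (Complex.exp w).re * (Complex.exp w).im))
            ≤ ‖L (Complex.exp w)‖ * 1 := by
              gcongr
              rw [Real.exp_le_one_iff, neg_nonpos]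
              positivity
          _ ≤ C * Real.exp (A * (Complex.exp w).re ^ 2) := by
              rw [mul_one]; exact hgr _ h0 h1
          _ ≤ C * Real.exp (A * Real.exp (2 * |w.re|)) := by
              gcongr
              have h2 : (Complex.exp w).re ≤ Real.exp w.re := by
                rw [← Complex.norm_exp]; exact Complex.re_le_norm _
              calc (Complex.exp w).re ^ 2 ≤ Real.exp w.re ^ 2 := by gcongr
                _ = Real.exp (2 * w.re) := by rw [← Real.exp_nat_mul]; simp
                _ ≤ Real.exp (2 * |w.re|) := by gcongr; exact le_abs_self _
    · intro w hw
      have hw' : Complex.exp w = (Real.exp w.re : ℝ) := by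
        conv_lhs => rw [← Complex.re_add_im w, hw]
        simp
      change ‖F (Complex.exp w)‖ ≤ C
      rw [hw', hFn]
      simpa using hre _ (Real.exp_pos w.re).le
    · intro w hw
      apply hsteep _ (hexpre w (by rw [hw]; exact hθ0.le) hw.le)
      rw [Complex.exp_re, Complex.exp_im, hw]
      have hcos : 0 < Real.cos θ := Real.cos_pos_of_mem_Ioo ⟨by linarith, hθ1⟩
      have : Real.sin θ = A / (2 * δ) * Real.cos θ := by
        rw [← Real.tan_mul_cos hcos.ne', hθ, Real.tan_arctan]
      rw [this]
      apply le_of_eq; ring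
    · simpa [Complex.log_im] using harg0
    · simpa [Complex.log_im] using hargθ
  have hlim : Filter.Tendsto (fun δ : ℝ => C * Real.exp (2 * δ * z.re * z.im))
      (nhdsWithin 0 (Set.Ioi 0)) (nhds C) := by
    have : Continuous fun δ : ℝ => C * Real.exp (2 * δ * z.re * z.im) := by fun_prop
    simpa using (this.tendsto 0).mono_left nhdsWithin_le_nhds
  exact ge_of_tendsto hlim (eventually_mem_nhdsWithin.mono key)

/-- Dividing by `(1 + z)^m`, which is zero-free and comparable to `(1 + ‖z‖)^m` for `Re z ≥ 0`,
reduces to the bounded case. -/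
theorem norm_le_of_gaussian_growth_of_re_nonneg {K : ℂ → ℂ} (hK : Differentiable ℂ K)
    {A C : ℝ} (hA : 0 < A) {m : ℕ}
    (hre : ∀ x : ℝ, ‖K x‖ ≤ C * (1 + |x|) ^ m)
    (hgr : ∀ z : ℂ, ‖K z‖ ≤ C * (1 + ‖z‖) ^ m * Real.exp (A * z.re ^ 2))
    {z : ℂ} (hz : 0 ≤ z.re) (hz' : 0 ≤ z.im) : ‖K z‖ ≤ C * 4 ^ m * (1 + ‖z‖) ^ m := by
  have hC : 0 ≤ C := by simpa using (norm_nonneg _).trans (hre 0)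
  have hlow : ∀ w : ℂ, 0 ≤ w.re → 1 + ‖w‖ ≤ 2 * ‖1 + w‖ := by
    intro w hw
    have h1 : 1 ≤ ‖1 + w‖ := by
      have := Complex.re_le_norm (1 + w)
      simp only [Complex.add_re, Complex.one_re] at this
      linarith
    have h2 : ‖w‖ ≤ ‖1 + w‖ := by
      rw [← sq_le_sq₀ (norm_nonneg _) (norm_nonneg _), Complex.sq_norm, Complex.sq_norm,
        Complex.normSq_apply, Complex.normSq_apply]
      simp only [Complex.add_re, Complex.one_re, Complex.add_im, Complex.one_im]
      nlinarith
    linarith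
  have hne : ∀ w : ℂ, 0 ≤ w.re → 1 + w ≠ 0 := by
    intro w hw h
    have := congrArg Complex.re h
    simp only [Complex.add_re, Complex.one_re, Complex.zero_re] at this
    linarith
  have hdiv : ∀ (w : ℂ) (B : ℝ), 0 ≤ w.re → 0 ≤ B → ‖K w‖ ≤ C * (1 + ‖w‖) ^ m * B →
      ‖K w / (1 + w) ^ m‖ ≤ C * 2 ^ m * B := by
    intro w B hw hB h
    rw [norm_div, norm_pow, div_le_iff₀ (pow_pos (norm_pos_iff.mpr (hne w hw)) _)]
    calc ‖K w‖ ≤ C * (1 + ‖w‖) ^ m * B := h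
      _ ≤ C * (2 * ‖1 + w‖) ^ m * B := by gcongr; exact hlow w hw
      _ = C * 2 ^ m * B * ‖1 + w‖ ^ m := by rw [mul_pow]; ring
  have := quadrant_norm_le_of_gaussian_growth (L := fun w => K w / (1 + w) ^ m)
    (C := C * 2 ^ m) (A := A) (z := z)
    (fun w hw => (hK w).div (by fun_prop) (pow_ne_zero _ (hne w hw))) hA
    (fun x hx => by simpa using hdiv x 1 (by simpa using hx) zero_le_one (by simpa using hre x))
    (fun w hw _ => hdiv w _ hw (Real.exp_pos _).le (hgr w)) hz hz'
  rw [norm_div, norm_pow, div_le_iff₀ (pow_pos (norm_pos_iff.mpr (hne z hz)) _)] at this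
  calc ‖K z‖ ≤ C * 2 ^ m * ‖1 + z‖ ^ m := this
    _ ≤ C * 2 ^ m * (1 + ‖z‖) ^ m := by
      gcongr
      simpa using norm_add_le (1 : ℂ) z
    _ ≤ C * 4 ^ m * (1 + ‖z‖) ^ m := by
      gcongr
      norm_num

/-- Conjugation and `z ↦ -z` preserve the hypotheses and carry every quadrant to the first. -/
theorem norm_le_of_gaussian_growth {K : ℂ → ℂ} (hK : Differentiable ℂ K)
    {A C : ℝ} (hA : 0 < A) {m : ℕ}
    (hre : ∀ x : ℝ, ‖K x‖ ≤ C * (1 + |x|) ^ m)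
    (hgr : ∀ z : ℂ, ‖K z‖ ≤ C * (1 + ‖z‖) ^ m * Real.exp (A * z.re ^ 2)) (z : ℂ) :
    ‖K z‖ ≤ C * 4 ^ m * (1 + ‖z‖) ^ m := by
  have half : ∀ {K : ℂ → ℂ}, Differentiable ℂ K → (∀ x : ℝ, ‖K x‖ ≤ C * (1 + |x|) ^ m) →
      (∀ z : ℂ, ‖K z‖ ≤ C * (1 + ‖z‖) ^ m * Real.exp (A * z.re ^ 2)) → ∀ z : ℂ, 0 ≤ z.re →
      ‖K z‖ ≤ C * 4 ^ m * (1 + ‖z‖) ^ m := by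
    intro K hK hre hgr z hz
    rcases le_total 0 z.im with hi | hi
    · exact norm_le_of_gaussian_growth_of_re_nonneg hK hA hre hgr hz hi
    · have := norm_le_of_gaussian_growth_of_re_nonneg
        (K := fun w => starRingEnd ℂ (K (starRingEnd ℂ w))) (z := starRingEnd ℂ z)
        (C := C) (m := m) (fun w => differentiableAt_conj_conj_iff.mpr (hK _)) hA
        (fun x => by simpa using hre x)
        (fun w => by simpa using hgr (starRingEnd ℂ w)) (by simpa using hz) (by simpa using hi)
      simpa using this
  rcases le_total 0 z.re with h | h
  · exact half hK hre hgr z h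
  · have := half (K := fun w => K (-w)) (hK.comp differentiable_neg)
      (fun x => by simpa using hre (-x)) (fun w => by simpa using hgr (-w)) (-z) (by simpa using h)
    simpa using this

/-! ### The one-variable theorem. -/

/-- The one-variable case: an entire function of Gaussian growth in imaginary directions which is
Gaussian integrable on the real line is a polynomial multiple of a Gaussian. -/
theorem entire_eq_polynomial_mul_gaussian {H : ℂ → ℂ} (hH : Differentiable ℂ H)
    {A C : ℝ} (hA : 0 < A) {n : ℕ}
    (hgr : ∀ z : ℂ, ‖H z‖ ≤ C * (1 + |z.im|) ^ n * Real.exp (A * z.im ^ 2))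
    (hint : Integrable fun x : ℝ => ‖H x‖ * (Real.exp (A * x ^ 2) / (1 + |x|) ^ n)) :
    ∃ p : Polynomial ℂ, p.natDegree ≤ n + 1 ∧
      ∀ x : ℝ, H x * Real.exp (A * x ^ 2) = p.eval (x : ℂ) := by
  have hC : 0 ≤ C := by simpa using (norm_nonneg _).trans (hgr 0)
  set G : ℂ → ℂ := fun z => H z * Complex.exp (A * z ^ 2) with hGdef
  have hG : Differentiable ℂ G := hH.mul (by fun_prop)
  have hGn : ∀ z, ‖G z‖ ≤ C * (1 + |z.im|) ^ n * Real.exp (A * z.re ^ 2) := by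
    intro z
    rw [hGdef, norm_mul, Complex.norm_exp]
    calc _ ≤ C * (1 + |z.im|) ^ n * Real.exp (A * z.im ^ 2) * Real.exp (A * z ^ 2 : ℂ).re := by
          gcongr; exact hgr z
      _ = _ := by
        rw [mul_assoc, ← Real.exp_add]
        congr 2
        simp [pow_two, Complex.mul_re]
        ring
  have hGreal : ∀ x : ℝ, G x = H x * Real.exp (A * x ^ 2) := by
    intro x; simp [hGdef]
  -- On the real axis `G` is controlled only in a weighted L¹ sense; its primitive is controlled
  -- pointwise.
  obtain ⟨K, hK0, hK⟩ := (hG.isExactOn_univ).with_val_at 0 0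
  replace hK : ∀ z, HasDerivAt K (G z) z := fun z => hK z (Set.mem_univ z)
  have hKd : Differentiable ℂ K := fun z => (hK z).differentiableAt
  set M := ∫ x : ℝ, ‖H x‖ * (Real.exp (A * x ^ 2) / (1 + |x|) ^ n) with hM
  have hM0 : 0 ≤ M := integral_nonneg fun x => by positivity
  have hKre : ∀ x : ℝ, ‖K x‖ ≤ M * (1 + |x|) ^ n := by
    intro x
    have hGc : Continuous fun t : ℝ => G t := hG.continuous.comp Complex.continuous_ofReal
    have hftc : ∫ t in (0 : ℝ)..x, G t = K x := by
      rw [intervalIntegral.integral_eq_sub_of_hasDerivAt (f := fun t : ℝ => K t)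
        (fun t _ => (hK t).comp_ofReal) (hGc.intervalIntegrable _ _)]
      simp [hK0]
    rw [← hftc]
    refine intervalIntegral.norm_integral_le_integral_norm_uIoc.trans ?_
    rw [mul_comm, hM, ← integral_const_mul]
    refine (setIntegral_mono_on ?_ (hint.const_mul ((1 + |x|) ^ n)).integrableOn
      measurableSet_uIoc ?_).trans (setIntegral_le_integral (hint.const_mul _)
        (Filter.Eventually.of_forall fun t => by dsimp; positivity))
    · exact (hGc.norm.integrableOn_uIcc).mono_set Set.uIoc_subset_uIcc
    · intro t ht
      have htx : |t| ≤ |x| := by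
        simpa using Set.abs_sub_left_of_mem_uIcc (Set.uIoc_subset_uIcc ht)
      rw [hGreal, norm_mul, Complex.norm_real, Real.norm_of_nonneg (Real.exp_pos _).le]
      have h1 : (1 + |t|) ^ n ≤ (1 + |x|) ^ n := by gcongr
      have h2 : 0 < (1 + |t|) ^ n := by positivity
      calc ‖H t‖ * Real.exp (A * t ^ 2)
          = (1 + |t|) ^ n * (‖H t‖ * (Real.exp (A * t ^ 2) / (1 + |t|) ^ n)) := by field_simp
        _ ≤ _ := by gcongr
  -- The mean value inequality on the segment from `0` to `z` costs a factor `‖z‖`, hence the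
  -- exponent `n + 1`.
  have hKgr : ∀ z : ℂ, ‖K z‖ ≤ C * (1 + ‖z‖) ^ (n + 1) * Real.exp (A * z.re ^ 2) := by
    intro z
    have := (convex_segment (𝕜 := ℝ) (0 : ℂ) z).norm_image_sub_le_of_norm_hasDerivWithin_le
      (f := K) (f' := G) (C := C * (1 + ‖z‖) ^ n * Real.exp (A * z.re ^ 2))
      (fun w _ => (hK w).hasDerivWithinAt) (fun w hw => ?_)
      (left_mem_segment ℝ 0 z) (right_mem_segment ℝ 0 z)
    · rw [hK0, sub_zero, sub_zero] at this
      calc ‖K z‖ ≤ C * (1 + ‖z‖) ^ n * Real.exp (A * z.re ^ 2) * ‖z‖ := this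
        _ ≤ C * (1 + ‖z‖) ^ n * Real.exp (A * z.re ^ 2) * (1 + ‖z‖) := by gcongr; linarith
        _ = _ := by ring
    · obtain ⟨s, ⟨hs0, hs1⟩, rfl⟩ := (segment_eq_image' ℝ (0 : ℂ) z) ▸ hw
      simp only [sub_zero, zero_add]
      refine (hGn _).trans ?_
      have h1 : |(s • z).im| ≤ ‖z‖ := by
        rw [Complex.smul_im, smul_eq_mul, abs_mul, abs_of_nonneg hs0]
        exact (mul_le_of_le_one_left (abs_nonneg _) hs1).trans (Complex.abs_im_le_norm z)
      have h2 : (s • z).re ^ 2 ≤ z.re ^ 2 := by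
        rw [Complex.smul_re, smul_eq_mul, mul_pow]
        exact mul_le_of_le_one_left (sq_nonneg _) (pow_le_one₀ hs0 hs1)
      gcongr
  obtain ⟨q, hq, hqK⟩ := entire_eq_polynomial_of_norm_le hKd (norm_le_of_gaussian_growth hKd
    (C := max M C) (m := n + 1) hA
    (fun x => (hKre x).trans (by
      gcongr
      · exact le_max_left _ _
      · linarith [abs_nonneg x]
      · exact n.le_succ))
    (fun z => (hKgr z).trans (by gcongr; exact le_max_right _ _)))
  refine ⟨q.derivative, (Polynomial.natDegree_derivative_le q).trans (by omega), fun x => ?_⟩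
  rw [← hGreal, ← (hK x).deriv, funext hqK, Polynomial.deriv]

/-! ### Interpolation and separately polynomial functions. -/

/-- Lagrange interpolation at the nodes `0, …, m`. -/
theorem Polynomial.eval_eq_sum_lagrange_nat (p : Polynomial ℂ) {m : ℕ} (hp : p.natDegree ≤ m)
    (z : ℂ) : p.eval z = ∑ k ∈ Finset.range (m + 1),
      (Lagrange.basis (Finset.range (m + 1)) (fun k : ℕ => (k : ℂ)) k).eval z * p.eval (k : ℂ) := by
  have h := Lagrange.eq_interpolate (s := Finset.range (m + 1)) (v := fun k : ℕ => (k : ℂ)) (f := p)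
    (fun _ _ _ _ h => by simpa using h)
    ((Polynomial.degree_le_of_natDegree_le hp).trans_lt (by
      rw [Finset.card_range]; exact_mod_cast Nat.lt_succ_self m))
  conv_lhs => rw [h]
  rw [Lagrange.interpolate_apply, Polynomial.eval_finsetSum]
  exact Finset.sum_congr rfl fun k _ => by simp [mul_comm]

/-- A function on `ℝᵈ` which is a polynomial of bounded degree in each variable separately
is a polynomial. -/
theorem exists_mvPolynomial_of_separately {d m : ℕ} (Φ : (Fin d → ℝ) → ℂ)
    (b : ℕ → Polynomial ℂ)
    (h : ∀ j x, Φ x = ∑ k ∈ Finset.range (m + 1),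
      (b k).eval (x j : ℂ) * Φ (Function.update x j (k : ℝ))) :
    ∃ P : MvPolynomial (Fin d) ℂ, ∀ x, Φ x = MvPolynomial.eval (fun i => (x i : ℂ)) P := by
  -- Induction on the set `s` of variables on which `Φ` may depend; freezing `x j` at a node removes
  -- `j` from `s`.
  suffices H : ∀ s : Finset (Fin d), ∀ Φ : (Fin d → ℝ) → ℂ,
      (∀ j ∈ s, ∀ x, Φ x = ∑ k ∈ Finset.range (m + 1),
        (b k).eval (x j : ℂ) * Φ (Function.update x j (k : ℝ))) →
      (∀ j ∉ s, ∀ x t, Φ (Function.update x j t) = Φ x) →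
      ∃ P : MvPolynomial (Fin d) ℂ, ∀ x, Φ x = MvPolynomial.eval (fun i => (x i : ℂ)) P from
    H Finset.univ Φ (fun j _ => h j) (fun j hj => absurd (Finset.mem_univ j) hj)
  intro s
  induction s using Finset.induction_on with
  | empty =>
    intro Φ _ h2
    refine ⟨MvPolynomial.C (Φ 0), fun x => ?_⟩
    rw [MvPolynomial.eval_C]
    have key : ∀ t : Finset (Fin d), ∀ x, (∀ i ∉ t, x i = 0) → Φ x = Φ 0 := by
      intro t
      induction t using Finset.induction_on with
      | empty =>
        intro x hx
        congr 1
        ext i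
        exact hx i (Finset.notMem_empty i)
      | insert j t hj ih =>
        intro x hx
        rw [← h2 j (Finset.notMem_empty j) x 0]
        refine ih _ fun i hi => ?_
        rcases eq_or_ne i j with rfl | hij
        · simp
        · rw [Function.update_of_ne hij]
          exact hx i (by simp [hij, hi])
    exact key Finset.univ x fun i hi => absurd (Finset.mem_univ i) hi
  | insert j s hj ih =>
    intro Φ h1 h2
    have hk : ∀ k : ℕ, ∃ P : MvPolynomial (Fin d) ℂ, ∀ x,
        Φ (Function.update x j (k : ℝ)) = MvPolynomial.eval (fun i => (x i : ℂ)) P := by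
      intro k
      refine ih (fun x => Φ (Function.update x j (k : ℝ))) (fun i hi x => ?_) (fun i hi x t => ?_)
      · have hij : i ≠ j := fun h => hj (h ▸ hi)
        rw [h1 i (Finset.mem_insert_of_mem hi), Function.update_of_ne hij]
        simp_rw [Function.update_comm hij]
      · rcases eq_or_ne i j with rfl | hij
        · simp
        · rw [Function.update_comm hij, h2 i (by simp [hij, hi])]
    choose P hP using hk
    refine ⟨∑ k ∈ Finset.range (m + 1), Polynomial.aeval (MvPolynomial.X j) (b k) * P k,
      fun x => ?_⟩
    rw [h1 j (Finset.mem_insert_self j s), map_sum]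
    refine Finset.sum_congr rfl fun k _ => ?_
    rw [map_mul, hP]
    congr 1
    rw [← MvPolynomial.coe_aeval_eq_eval, RingHom.coe_coe, ← Polynomial.aeval_algHom_apply]
    simp

/-! ### Fourier–Laplace transforms under Gaussian weights. -/

/-- As `ab = 1`, `πas² + πbt² - 2πst = πb(t - as)²`. The spare Gaussian in `u = |t - as|` absorbs
the powers of `1 + u` coming from `1 + t ≤ (1 + a)(1 + s)(1 + u)`. -/
theorem exists_exp_mul_le_gaussian_weight {a b : ℝ} (ha : 0 < a) (hb : 0 < b) (hab : a * b = 1)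
    (n : ℕ) : ∃ D : ℝ, ∀ s t : ℝ, 0 ≤ s → 0 ≤ t →
      Real.exp (2 * Real.pi * s * t) ≤ D * (1 + s) ^ n * Real.exp (Real.pi * a * s ^ 2) *
        (Real.exp (Real.pi * b * t ^ 2) / (1 + t) ^ n) := by
  refine ⟨(n.factorial * Real.exp (1 + 1 / (4 * (Real.pi * b)))) * (1 + a) ^ n,
    fun s t hs ht => ?_⟩
  set u := |t - a * s|
  have hπb : 0 < Real.pi * b := by positivity
  -- The constant comes from `(1 + u)^n ≤ n! exp(1 + u)` and `u - πbu² ≤ 1/(4πb)`.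
  have h1 : (1 + u) ^ n * Real.exp (-(Real.pi * b * u ^ 2)) ≤
      n.factorial * Real.exp (1 + 1 / (4 * (Real.pi * b))) := by
    have h := Real.pow_div_factorial_le_exp (1 + u) (by positivity) n
    rw [div_le_iff₀ (by positivity)] at h
    calc (1 + u) ^ n * Real.exp (-(Real.pi * b * u ^ 2))
        ≤ Real.exp (1 + u) * n.factorial * Real.exp (-(Real.pi * b * u ^ 2)) := by gcongr
      _ = n.factorial * Real.exp (1 + (u - Real.pi * b * u ^ 2)) := by
        rw [mul_right_comm, ← Real.exp_add]; ring_nf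
      _ ≤ _ := by
        gcongr
        rw [le_div_iff₀ (by positivity)]
        nlinarith [sq_nonneg (2 * (Real.pi * b) * u - 1)]
  have h2 : 1 + t ≤ (1 + a) * (1 + s) * (1 + u) := by
    have : t ≤ a * s + u := by linarith [le_abs_self (t - a * s)]
    have hu : 0 ≤ u := abs_nonneg _
    have := mul_nonneg ha.le hs
    nlinarith [mul_nonneg ha.le hu, mul_nonneg hs hu, mul_nonneg this hu]
  have h3 : Real.exp (2 * Real.pi * s * t) = Real.exp (Real.pi * a * s ^ 2) *
      Real.exp (Real.pi * b * t ^ 2) * Real.exp (-(Real.pi * b * u ^ 2)) := by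
    rw [← Real.exp_add, ← Real.exp_add, sq_abs]
    congr 1
    linear_combination (-2 * Real.pi * s * t + Real.pi * a * s ^ 2) * hab
  have h4 : 0 < (1 + t) ^ n := by positivity
  rw [← mul_div_assoc, le_div_iff₀ h4, h3]
  calc _ ≤ Real.exp (Real.pi * a * s ^ 2) * Real.exp (Real.pi * b * t ^ 2) *
        Real.exp (-(Real.pi * b * u ^ 2)) * ((1 + a) * (1 + s) * (1 + u)) ^ n := by gcongr
    _ = ((1 + u) ^ n * Real.exp (-(Real.pi * b * u ^ 2))) * ((1 + a) ^ n * (1 + s) ^ n *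
        Real.exp (Real.pi * a * s ^ 2) * Real.exp (Real.pi * b * t ^ 2)) := by
      rw [mul_pow, mul_pow]; ring
    _ ≤ (n.factorial * Real.exp (1 + 1 / (4 * (Real.pi * b)))) * ((1 + a) ^ n * (1 + s) ^ n *
        Real.exp (Real.pi * a * s ^ 2) * Real.exp (Real.pi * b * t ^ 2)) := by gcongr
    _ = _ := by ring

theorem norm_cexp_two_pi_I_mul (z : ℂ) (t : ℝ) :
    ‖Complex.exp (2 * Real.pi * Complex.I * z * t)‖ = Real.exp (-(2 * Real.pi * z.im * t)) := by
  rw [Complex.norm_exp]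
  congr 1
  simp [Complex.mul_re, Complex.mul_im]

theorem integrable_mul_exp_of_gaussian_weight {α : Type*} [MeasurableSpace α] {μ : Measure α}
    {k : α → ℂ} {u : α → ℝ} (hk : AEStronglyMeasurable k μ) (hu : AEMeasurable u μ)
    {b : ℝ} (hb : 0 < b) {n : ℕ}
    (hint : Integrable (fun y => ‖k y‖ *
      (Real.exp (Real.pi * b * |u y| ^ 2) / (1 + |u y|) ^ n)) μ) {R : ℝ} (hR : 0 ≤ R) :
    Integrable (fun y => ‖k y‖ * Real.exp (R * |u y|)) μ := by
  obtain ⟨D, hD⟩ := exists_exp_mul_le_gaussian_weight (a := 1 / b) (by positivity) hb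
    (by field_simp) n
  set s := R / (2 * Real.pi)
  refine (hint.const_mul (D * (1 + s) ^ n * Real.exp (Real.pi * (1 / b) * s ^ 2))).mono'
    (hk.norm.mul (by fun_prop)) (Filter.Eventually.of_forall fun y => ?_)
  have hs : 2 * Real.pi * s = R := by simp only [s]; field_simp
  have := hD s |u y| (by positivity) (abs_nonneg _)
  rw [hs] at this
  rw [Real.norm_of_nonneg (by positivity)]
  exact (mul_le_mul_of_nonneg_left this (norm_nonneg _)).trans_eq (by ring)

/-- The Fourier–Laplace transform of a function with Gaussian decay is entire. -/
theorem differentiable_integral_mul_cexp {α : Type*} [MeasurableSpace α] {μ : Measure α}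
    {k : α → ℂ} {u : α → ℝ} (hk : AEStronglyMeasurable k μ) (hu : AEMeasurable u μ)
    (hint : ∀ R : ℝ, 0 ≤ R → Integrable (fun y => ‖k y‖ * Real.exp (R * |u y|)) μ) :
    Differentiable ℂ fun z : ℂ => ∫ y, k y * Complex.exp (2 * Real.pi * Complex.I * z * u y) ∂μ := by
  intro z₀
  set R : ℝ := 2 * Real.pi * (‖z₀‖ + 1)
  have hmeas : ∀ z : ℂ, AEStronglyMeasurable
      (fun y => k y * Complex.exp (2 * Real.pi * Complex.I * z * u y)) μ := fun z =>
    hk.mul (by fun_prop)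
  have hbd : ∀ z ∈ Metric.ball z₀ 1, ∀ t : ℝ,
      ‖Complex.exp (2 * Real.pi * Complex.I * z * t)‖ ≤ Real.exp (R * |t|) := by
    intro z hz t
    rw [norm_cexp_two_pi_I_mul]
    gcongr
    have h1 : |z.im| ≤ ‖z₀‖ + 1 := by
      have h2 := norm_le_norm_add_norm_sub' z z₀
      rw [Metric.mem_ball, dist_eq_norm] at hz
      linarith [Complex.abs_im_le_norm z]
    calc -(2 * Real.pi * z.im * t) ≤ |2 * Real.pi * z.im * t| := neg_le_abs _
      _ = 2 * Real.pi * |z.im| * |t| := by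
        rw [abs_mul, abs_mul, abs_of_pos Real.two_pi_pos]
      _ ≤ R * |t| := by simp only [R]; gcongr
  -- The rate `R + 1` in the bound absorbs the factor `|u y|` produced by differentiation.
  refine (hasDerivAt_integral_of_dominated_loc_of_deriv_le (s := Metric.ball z₀ 1)
    (F' := fun z y => k y * (Complex.exp (2 * Real.pi * Complex.I * z * u y) *
      (2 * Real.pi * Complex.I * u y)))
    (bound := fun y => 2 * Real.pi * (‖k y‖ * Real.exp ((R + 1) * |u y|)))
    (Metric.ball_mem_nhds z₀ one_pos) (Filter.Eventually.of_forall hmeas) ?_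
    (hk.mul (by fun_prop)) ?_ ((hint (R + 1) (by positivity)).const_mul _) ?_).2.differentiableAt
  · refine (hint R (by positivity)).mono' (hmeas z₀) (Filter.Eventually.of_forall fun y => ?_)
    rw [norm_mul]
    gcongr
    exact hbd z₀ (Metric.mem_ball_self one_pos) _
  · refine Filter.Eventually.of_forall fun y z hz => ?_
    rw [norm_mul, norm_mul]
    have h1 : ‖(2 * Real.pi * Complex.I * u y : ℂ)‖ = 2 * Real.pi * |u y| := by
      simp [abs_of_pos Real.pi_pos]
    have h2 : |u y| ≤ Real.exp |u y| := by linarith [Real.add_one_le_exp |u y|]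
    rw [h1]
    calc _ ≤ ‖k y‖ * (Real.exp (R * |u y|) * (2 * Real.pi * Real.exp |u y|)) := by
          gcongr; exact hbd z hz _
      _ = 2 * Real.pi * (‖k y‖ * (Real.exp (R * |u y|) * Real.exp |u y|)) := by ring
      _ = _ := by rw [← Real.exp_add]; ring_nf
  · refine Filter.Eventually.of_forall fun y z _ => ?_
    have : HasDerivAt (fun z : ℂ => 2 * Real.pi * Complex.I * z * u y)
        (2 * Real.pi * Complex.I * u y) z := by
      simpa using! ((hasDerivAt_id z).const_mul (2 * Real.pi * Complex.I : ℂ)).mul_const (u y : ℂ)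
    exact this.cexp.const_mul (k y)

theorem exists_norm_integral_mul_cexp_le {α : Type*} [MeasurableSpace α] {μ : Measure α}
    {k : α → ℂ} {u : α → ℝ} {a b : ℝ} (ha : 0 < a) (hb : 0 < b) (hab : a * b = 1) {n : ℕ}
    (hint : Integrable (fun y => ‖k y‖ *
      (Real.exp (Real.pi * b * |u y| ^ 2) / (1 + |u y|) ^ n)) μ) :
    ∃ C : ℝ, ∀ z : ℂ, ‖∫ y, k y * Complex.exp (2 * Real.pi * Complex.I * z * u y) ∂μ‖ ≤
      C * (1 + |z.im|) ^ n * Real.exp (Real.pi * a * z.im ^ 2) := by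
  obtain ⟨D, hD⟩ := exists_exp_mul_le_gaussian_weight ha hb hab n
  refine ⟨D * ∫ y, ‖k y‖ * (Real.exp (Real.pi * b * |u y| ^ 2) / (1 + |u y|) ^ n) ∂μ, fun z => ?_⟩
  set E := D * (1 + |z.im|) ^ n * Real.exp (Real.pi * a * z.im ^ 2) with hE
  refine (norm_integral_le_of_norm_le (hint.const_mul E)
    (Filter.Eventually.of_forall fun y => ?_)).trans (le_of_eq ?_)
  · rw [norm_mul, norm_cexp_two_pi_I_mul]
    have := hD |z.im| |u y| (abs_nonneg _) (abs_nonneg _)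
    rw [sq_abs z.im, ← hE] at this
    have h2 : -(2 * Real.pi * z.im * u y) ≤ 2 * Real.pi * |z.im| * |u y| := by
      refine (neg_le_abs _).trans (le_of_eq ?_)
      rw [abs_mul, abs_mul, abs_of_pos Real.two_pi_pos]
    calc _ ≤ ‖k y‖ * (E * (Real.exp (Real.pi * b * |u y| ^ 2) / (1 + |u y|) ^ n)) := by
          gcongr
          exact (Real.exp_le_exp.mpr h2).trans this
      _ = _ := by ring
  · rw [integral_const_mul, hE]; ring

/-! ### From lines to the whole space. -/

/-- A continuous function on `ℝⁿ⁺¹` with entire extensions of Gaussian growth along the lines in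
the `j`-th direction, and with Gaussian decay in the `j`-th variable, is a Gaussian times a function
which is polynomial in the `j`-th variable. -/
theorem gaussian_mul_eq_lagrange_sum {n m : ℕ} (j : Fin (n + 1)) {Φ : (Fin (n + 1) → ℝ) → ℂ}
    (hΦ : Continuous Φ) {A : ℝ} (hA : 0 < A)
    (hent : ∀ x, ∃ H : ℂ → ℂ, Differentiable ℂ H ∧
      (∃ C : ℝ, ∀ z : ℂ, ‖H z‖ ≤ C * (1 + |z.im|) ^ m * Real.exp (A * z.im ^ 2)) ∧
      ∀ t : ℝ, H t = Φ (Function.update x j t))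
    (hint : Integrable fun x : Fin (n + 1) → ℝ =>
      ‖Φ x‖ * (Real.exp (A * x j ^ 2) / (1 + |x j|) ^ m)) (x : Fin (n + 1) → ℝ) :
    Φ x * Real.exp (A * ∑ i, x i ^ 2) = ∑ k ∈ Finset.range (m + 1 + 1),
      (Lagrange.basis (Finset.range (m + 1 + 1)) (fun k : ℕ => (k : ℂ)) k).eval (x j : ℂ) *
        (Φ (Function.update x j (k : ℝ)) *
          Real.exp (A * ∑ i, Function.update x j (k : ℝ) i ^ 2)) := by
  set L : ℕ → Polynomial ℂ :=
    Lagrange.basis (Finset.range (m + 1 + 1)) (fun k : ℕ => (k : ℂ)) with hL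
  set Ψ : (Fin (n + 1) → ℝ) → ℂ := fun x => Φ x * Real.exp (A * ∑ i, x i ^ 2) with hΨ
  have hΨc : Continuous Ψ := by
    simp only [hΨ]; fun_prop
  have hins : ∀ t : ℝ, Continuous fun y : Fin n → ℝ => (j.insertNth t y : Fin (n + 1) → ℝ) :=
    fun t => Continuous.finInsertNth (A := fun _ => ℝ) j continuous_const continuous_id
  -- Base points of lines on which interpolation holds. With nodes and basis fixed, this set is
  -- closed; Fubini makes it of full measure, hence dense.
  set S : Set (Fin n → ℝ) := {y | ∀ t : ℝ, Ψ (j.insertNth t y) =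
    ∑ k ∈ Finset.range (m + 1 + 1), (L k).eval (t : ℂ) * Ψ (j.insertNth (k : ℝ) y)} with hS
  have hSc : IsClosed S := by
    rw [hS, Set.ofPred_forall]
    refine isClosed_iInter fun t => isClosed_eq (hΨc.comp (hins t)) ?_
    exact continuous_finsetSum _ fun k _ => continuous_const.mul (hΨc.comp (hins k))
  have hSd : Dense S := by
    have hmp := (volume_preserving_piFinSuccAbove (fun _ : Fin (n + 1) => ℝ) j).symm
    have h1 := (hmp.integrable_comp_emb (MeasurableEquiv.measurableEmbedding _)).mpr hint
    refine Measure.dense_of_ae (μ := (volume : Measure (Fin n → ℝ)))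
      (h1.prod_left_ae.mono fun y hy => ?_)
    obtain ⟨H, hHd, ⟨C, hC⟩, hH⟩ := hent (j.insertNth 0 y)
    have hH' : ∀ t : ℝ, H t = Φ (j.insertNth t y) := by
      intro t; rw [hH, Fin.update_insertNth]
    obtain ⟨p, hp, hpH⟩ := entire_eq_polynomial_mul_gaussian hHd hA hC (by
      refine hy.congr (Filter.Eventually.of_forall fun t => ?_)
      have hsymm : (MeasurableEquiv.piFinSuccAbove (fun _ : Fin (n + 1) => ℝ) j).symm (t, y) =
        j.insertNth t y := rfl
      simp only [Function.comp_apply, hsymm, hH', Fin.insertNth_apply_same])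
    have hΨp : ∀ t : ℝ, Ψ (j.insertNth t y) =
        p.eval (t : ℂ) * Real.exp (A * ∑ i, y i ^ 2) := by
      intro t
      simp only [hΨ, Fin.sum_univ_succAbove _ j, Fin.insertNth_apply_same,
        Fin.insertNth_apply_succAbove, mul_add, Real.exp_add, Complex.ofReal_mul]
      rw [← hpH, hH']
      ring
    intro t
    rw [hΨp, p.eval_eq_sum_lagrange_nat hp, Finset.sum_mul]
    refine Finset.sum_congr rfl fun k _ => ?_
    rw [hΨp]
    push_cast
    ring
  have hx : j.removeNth x ∈ S := by
    rw [hSc.closure_eq.symm.trans hSd.closure_eq]; trivial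
  have := hx (x j)
  have hupd : ∀ t, (j.insertNth t (j.removeNth x) : Fin (n + 1) → ℝ) = Function.update x j t :=
    fun t => by rw [Fin.insertNth_removeNth]
  simpa only [hupd, Function.update_eq_self] using this

/-- Rounding `N` up only weakens the weight, and integer exponents suit the polynomial estimates. -/
theorem integrable_gaussian_weight_natCeil {α : Type*} [MeasurableSpace α] {μ : Measure α}
    {k : α → ℂ} {u : α → ℝ} (hk : AEStronglyMeasurable k μ) (hu : AEMeasurable u μ) {B N : ℝ}
    (hint : Integrable (fun y => ‖k y‖ * (Real.exp (B * |u y| ^ 2) / (1 + |u y|) ^ N)) μ) :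
    Integrable (fun y => ‖k y‖ * (Real.exp (B * |u y| ^ 2) / (1 + |u y|) ^ ⌈N⌉₊)) μ := by
  refine hint.mono' (hk.norm.mul (AEMeasurable.aestronglyMeasurable (by fun_prop))) (Filter.Eventually.of_forall fun y => ?_)
  rw [Real.norm_of_nonneg (by positivity)]
  gcongr
  rw [← Real.rpow_natCast]
  exact Real.rpow_le_rpow_of_exponent_le (by linarith [abs_nonneg (u y)]) (Nat.le_ceil N)

theorem EuclideanSpace.inner_toLp_update {n : ℕ} (j : Fin (n + 1)) (x : Fin (n + 1) → ℝ) (t : ℝ)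
    (y : EuclideanSpace ℝ (Fin (n + 1))) :
    inner ℝ y (WithLp.toLp 2 (Function.update x j t)) =
      inner ℝ y (WithLp.toLp 2 (Function.update x j 0)) + t * y j := by
  simp [PiLp.inner_apply, Fin.sum_univ_succAbove _ j]
  ring

/-- Moving along the `j`-th axis only inserts `exp(2πi t y_j)`. The phase from the other coordinates
is unimodular and is absorbed into `k` without changing the weighted norm. -/
theorem exists_entire_extension_fourierInv {n m : ℕ} {g : EuclideanSpace ℝ (Fin (n + 1)) → ℂ}
    (hg : AEStronglyMeasurable g volume) {a b : ℝ} (ha : 0 < a) (hb : 0 < b) (hab : a * b = 1)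
    (j : Fin (n + 1))
    (hint : Integrable fun y : EuclideanSpace ℝ (Fin (n + 1)) =>
      ‖g y‖ * (Real.exp (Real.pi * b * |y j| ^ 2) / (1 + |y j|) ^ m)) (x : Fin (n + 1) → ℝ) :
    ∃ H : ℂ → ℂ, Differentiable ℂ H ∧
      (∃ C : ℝ, ∀ z : ℂ, ‖H z‖ ≤ C * (1 + |z.im|) ^ m * Real.exp (Real.pi * a * z.im ^ 2)) ∧
      ∀ t : ℝ, H t = 𝓕⁻ g (WithLp.toLp 2 (Function.update x j t)) := by
  set v : EuclideanSpace ℝ (Fin (n + 1)) := WithLp.toLp 2 (Function.update x j 0)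
  set k : EuclideanSpace ℝ (Fin (n + 1)) → ℂ := fun y =>
    Complex.exp ((2 * Real.pi * inner ℝ y v : ℝ) * Complex.I) * g y with hk
  have hkn : ∀ y, ‖k y‖ = ‖g y‖ := fun y => by
    rw [hk, norm_mul, Complex.norm_exp_ofReal_mul_I, one_mul]
  have hkm : AEStronglyMeasurable k volume :=
    (Continuous.aestronglyMeasurable (by fun_prop)).mul hg
  have hu : AEMeasurable (fun y : EuclideanSpace ℝ (Fin (n + 1)) => y j) volume := by fun_prop
  have hint' : Integrable fun y : EuclideanSpace ℝ (Fin (n + 1)) =>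
      ‖k y‖ * (Real.exp (Real.pi * b * |y j| ^ 2) / (1 + |y j|) ^ m) := by
    simpa only [hkn] using hint
  refine ⟨_, differentiable_integral_mul_cexp hkm hu fun R hR =>
    integrable_mul_exp_of_gaussian_weight hkm hu hb hint' hR,
    exists_norm_integral_mul_cexp_le ha hb hab hint', fun t => ?_⟩
  rw [Real.fourierInv_eq']
  congr 1
  ext y
  rw [EuclideanSpace.inner_toLp_update, smul_eq_mul, hk, mul_right_comm, ← Complex.exp_add]
  congr 2
  push_cast
  ring

/-- Cowling–Price type theorem. `f` is an element of `L²(ℝᵈ; ℂ)` and `𝓕 f` is its `L²` (Plancherel)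
Fourier transform, normalized by `𝓕 f (y) = ∫ f(t) exp(-2πi⟨t, y⟩) dt`. -/
theorem mainTheorem6 (d : ℕ) (hd : 1 ≤ d) (N : ℝ) (hN : 0 ≤ N)
    (f : Lp (α := EuclideanSpace ℝ (Fin d)) ℂ 2 volume)
    (a b : ℝ) (ha : 0 < a) (hb : 0 < b) (hab : a * b = 1)
    (hf : ∀ j : Fin d, Integrable (fun x : EuclideanSpace ℝ (Fin d) =>
      ‖f x‖ * (Real.exp (Real.pi * a * |x j| ^ 2) / (1 + |x j|) ^ N)) volume)
    (hf' : ∀ j : Fin d, Integrable (fun y : EuclideanSpace ℝ (Fin d) =>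
      ‖(𝓕 f : Lp (α := EuclideanSpace ℝ (Fin d)) ℂ 2 volume) y‖ *
        (Real.exp (Real.pi * b * |y j| ^ 2) / (1 + |y j|) ^ N)) volume) :
    ∃ P : MvPolynomial (Fin d) ℂ, ∀ᵐ x : EuclideanSpace ℝ (Fin d) ∂volume,
      f x = MvPolynomial.eval (fun i => (x i : ℂ)) P *
        (Real.exp (-(Real.pi * a * ‖x‖ ^ 2)) : ℂ) := by
  obtain ⟨n, rfl⟩ : ∃ n, d = n + 1 := ⟨d - 1, by omega⟩
  set g : Lp (α := EuclideanSpace ℝ (Fin (n + 1))) ℂ 2 volume := 𝓕 f with hg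
  have hgm : AEStronglyMeasurable g volume := (Lp.memLp g).aestronglyMeasurable
  have hfm : AEStronglyMeasurable f volume := (Lp.memLp f).aestronglyMeasurable
  have hum : ∀ j, AEMeasurable (fun y : EuclideanSpace ℝ (Fin (n + 1)) => y j) volume :=
    fun j => by fun_prop
  have hfN := fun j => integrable_gaussian_weight_natCeil hfm (hum j) (hf j)
  have hgN := fun j => integrable_gaussian_weight_natCeil hgm (hum j) (hf' j)
  have hgi : Integrable g volume := by
    -- Exponential rate `R = 0`; coordinate `0` exists because `d ≥ 1`.
    have := integrable_mul_exp_of_gaussian_weight hgm (hum 0) hb (hgN 0) le_rfl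
    simp only [zero_mul, Real.exp_zero, mul_one] at this
    exact (integrable_norm_iff hgm).mp this
  have hfg : ∀ᵐ x, f x = 𝓕⁻ (g : EuclideanSpace ℝ (Fin (n + 1)) → ℂ) x := by
    have := Lp_fourierInv_ae_eq g hgi
    rwa [hg, FourierTransform.fourierInv_fourier_eq, ← hg] at this
  set Φ : (Fin (n + 1) → ℝ) → ℂ := fun x =>
    𝓕⁻ (g : EuclideanSpace ℝ (Fin (n + 1)) → ℂ) (WithLp.toLp 2 x) with hΦ
  have hΦc : Continuous Φ :=
    (continuous_fourierInv_of_integrable hgi).comp (PiLp.continuous_toLp 2 _)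
  have hΦi : ∀ j, Integrable fun x : Fin (n + 1) → ℝ =>
      ‖Φ x‖ * (Real.exp (Real.pi * a * x j ^ 2) / (1 + |x j|) ^ ⌈N⌉₊) := by
    intro j
    have h1 : Integrable fun x : EuclideanSpace ℝ (Fin (n + 1)) =>
        ‖𝓕⁻ (g : EuclideanSpace ℝ (Fin (n + 1)) → ℂ) x‖ *
          (Real.exp (Real.pi * a * |x j| ^ 2) / (1 + |x j|) ^ ⌈N⌉₊) :=
      (hfN j).congr (hfg.mono fun x hx => by simp only [hx])
    have h2 := ((PiLp.volume_preserving_toLp (Fin (n + 1))).integrable_comp_emb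
      (MeasurableEquiv.toLp 2 _).measurableEmbedding).mpr h1
    simpa only [Function.comp_def, sq_abs] using h2
  obtain ⟨P, hP⟩ := exists_mvPolynomial_of_separately
    (fun x => Φ x * Real.exp (Real.pi * a * ∑ i, x i ^ 2)) _ fun j x =>
      gaussian_mul_eq_lagrange_sum j hΦc (by positivity)
        (exists_entire_extension_fourierInv hgm ha hb hab j (hgN j)) (hΦi j) x
  refine ⟨P, hfg.mono fun x hx => ?_⟩
  have h := hP (WithLp.ofLp x)
  have hnorm : ∑ i, x i ^ 2 = ‖x‖ ^ 2 := by simp [EuclideanSpace.norm_sq_eq]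
  rw [hx, ← h, hnorm, mul_assoc, ← Complex.ofReal_mul, ← Real.exp_add]
  simp [hΦ]
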